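/- Let $G$ be a connected, simply connected nilpotent Lie group with Lie algebra $\mathfrak g$, let $\mathrm{Aff}(G)=G\rtimes\mathrm{Aut}(G)$ act on $G$ by $(g,\alpha)\cdot h=g\,\alpha(h)$, and let $p:\mathrm{Aff}(G)\to\mathrm{Aut}(G)$ be the projection. A subgroup $\Gamma\subseteq\mathrm{Aff}(G)$ is called almost-Bieberbach if it is torsion-free, $F=p(\Gamma)$ is finite, and $\Gamma\cap G$ is a discrete cocompact subgroup of $G$; then $\Gamma\backslash G$ is the associated infra-nilmanifold, and $\rho:F\to \mathrm{GL}(\mathfrak g)$, $\mathfrak A\mapsto\mathfrak A_*$ (the differential at the identity), is its holonomy representation. Let $\Gamma$ be almost-Bieberbach, let $M=\Gamma\backslash G$, and let $f:M\to M$ be a continuous map. Let $\delta\in G$ and let $\mathfrak D$ be an endomorphism of the Lie group $G$ such that $(\delta,\mathfrak D):G\to G$, $h\mapsto\delta\,\mathfrak D(h)$, is an affine homotopy lift of $f$; that is, there are a continuous lift $\tilde f:G\to G$ of $f$ and a morphism $\varphi:\Gamma\to\Gamma$ such that, for all $\gamma\in\Gamma$, $\varphi(\gamma)\circ\tilde f=\tilde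 f\circ\gamma$ and $\varphi(\gamma)\circ(\delta,\mathfrak D)=(\delta,\mathfrak D)\circ\gamma$. Then there is a decomposition $\rho=\rho_{\le 1}\oplus\rho_{>1}$ induced by $\mathfrak D$, i.e. a decomposition $\mathfrak g=V_{\le1}\oplus V_{>1}$ into $F$-invariant subspaces with respect to which $$\mathfrak D_*=\begin{pmatrix}D_{\le1}&*\\0&D_{>1}\end{pmatrix},$$ where all complex eigenvalues of $D_{\le1}$ have modulus $\le1$ and all complex eigenvalues of $D_{>1}$ have modulus $>1$. For every such decomposition (with $\det\rho_{>1}=1$ if $V_{>1}=0$), the set $$\Gamma_+=\{\gamma\in\Gamma : \det\rho_{>1}(p(\gamma))=1\}$$ is a normal subgroup of $\Gamma$ of index $1$ or $2$ and is again almost-Bieberbach. Let $M_+=\Gamma_+\backslash G$. Either $\Gamma_+=\Gamma$ (so that $M_+=M$), or $[\Gamma:\Gamma_+]=2$, the natural map $\pi:M_+\to M$, $\Gamma_+h\mapsto\Gamma h$, is a $2$-fold covering, and $f$ lifts to a continuous map $f_+:M_+\to M_+$ (so $\pi\circ f_+=f\circ\pi$) that has the same affine homotopy lift $(\delta,\mathfrak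 D)$ as $f$. -/

import Mathlib

open scoped Manifold ContDiff

noncomputable section

/-! ### Lie group endomorphisms, automorphisms and their differentials -/

section LieMaps

variable (E : Type*) [NormedAddCommGroup E] [NormedSpace ℝ E]
  (G : Type*) [TopologicalSpace G] [ChartedSpace E G] [Group G]

/-- `Endo(G)`: the smooth endomorphisms of the Lie group `G`. -/
abbrev LieEndo : Type _ := ContMDiffMonoidMorphism 𝓘(ℝ, E) 𝓘(ℝ, E) ∞ G G

/-- `Aut(G)`: the group automorphisms of `G` that are smooth with smooth inverse. -/
def LieAut : Subgroup (MulAut G) where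
  carrier := {α | ContMDiff 𝓘(ℝ, E) 𝓘(ℝ, E) ∞ (fun g : G => α g) ∧
    ContMDiff 𝓘(ℝ, E) 𝓘(ℝ, E) ∞ (fun g : G => α⁻¹ g)}
  one_mem' := ⟨contMDiff_id, contMDiff_id⟩
  mul_mem' := by
    rintro α β ⟨h1, h2⟩ ⟨h3, h4⟩
    refine ⟨h1.comp h3, ?_⟩
    have h := h4.comp h2
    simpa [mul_inv_rev, Function.comp_def, MulAut.mul_apply] using h
  inv_mem' := by
    rintro α ⟨h1, h2⟩
    exact ⟨h2, by simpa using h1⟩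

/-- The Lie algebra `𝔤` of `G` (as a real vector space): the tangent space at the identity. -/
abbrev LieAlg : Type _ := GroupLieAlgebra 𝓘(ℝ, E) G

instance LieAlg.instFiniteDimensional [FiniteDimensional ℝ E] :
    FiniteDimensional ℝ (LieAlg E G) :=
  inferInstanceAs (FiniteDimensional ℝ E)

variable {G}

/-- The differential `f_* : 𝔤 → 𝔤` at the identity of a group endomorphism `f` of `G`
(only used for smooth `f`). -/
def lieDifferential (f : G →* G) : Module.End ℝ (LieAlg E G) :=
  (mfderiv 𝓘(ℝ, E) 𝓘(ℝ, E) (f : G → G) 1).toLinearMap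

theorem lieDifferential_one : lieDifferential E (MonoidHom.id G) = 1 := by
  ext v
  change mfderiv 𝓘(ℝ, E) 𝓘(ℝ, E) (id : G → G) 1 v = v
  rw [mfderiv_id]
  rfl

theorem lieDifferential_mul {f g : G →* G}
    (hf : ContMDiff 𝓘(ℝ, E) 𝓘(ℝ, E) ∞ (f : G → G))
    (hg : ContMDiff 𝓘(ℝ, E) 𝓘(ℝ, E) ∞ (g : G → G)) :
    lieDifferential E (f.comp g) = lieDifferential E f * lieDifferential E g := by
  have h := mfderiv_comp_of_eq (I := 𝓘(ℝ, E)) (I' := 𝓘(ℝ, E)) (I'' := 𝓘(ℝ, E))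
    (x := (1 : G)) (y := (1 : G)) (g := (f : G → G)) (f := (g : G → G))
    (hf.mdifferentiable (by simp) 1) (hg.mdifferentiable (by simp) 1) (map_one g)
  have key : ∀ y : G, y = 1 → ∀ w : E, (mfderiv 𝓘(ℝ, E) 𝓘(ℝ, E) (f : G → G) y : E →L[ℝ] E) w =
      (mfderiv 𝓘(ℝ, E) 𝓘(ℝ, E) (f : G → G) 1 : E →L[ℝ] E) w := by
    rintro _ rfl w
    rfl
  ext v
  exact (DFunLike.congr_fun h v).trans (key _ (map_one g) _)

end LieMaps

/-! ### The affine group, almost-Bieberbach groups, infra-nilmanifolds -/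

section Affine

variable (E : Type*) [NormedAddCommGroup E] [NormedSpace ℝ E]
  (G : Type*) [TopologicalSpace G] [ChartedSpace E G] [Group G]

/-- `Aff(G) = G ⋊ Aut(G)`. -/
abbrev Aff : Type _ := G ⋊[(LieAut E G).subtype] (LieAut E G)

/-- The action of `Aff(G)` on `G`: `(g, α) • h = g * α h`. -/
instance Aff.instMulAction : MulAction (Aff E G) G where
  smul a h := a.left * (a.right : MulAut G) h
  one_smul h := by
    change (1 : Aff E G).left * ((1 : Aff E G).right : MulAut G) h = h
    simp
  mul_smul a b h := by
    change (a * b).left * ((a * b).right : MulAut G) h =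
      a.left * (a.right : MulAut G) (b.left * (b.right : MulAut G) h)
    simp [mul_assoc]

/-- The projection `p : Aff(G) → Aut(G)`. -/
abbrev Aff.proj : Aff E G →* LieAut E G := SemidirectProduct.rightHom

/-- `aff(G)`: the semigroup of affine endomorphisms `(δ, 𝔇)` of `G`. -/
structure AffEndo where
  /-- the translational part `δ` -/
  trans : G
  /-- the linear part `𝔇` -/
  lin : LieEndo E G

variable {E G}

/-- `(δ, 𝔇)` as a self-map of `G`: `h ↦ δ * 𝔇 h`. -/
def AffEndo.toFun (d : AffEndo E G) (h : G) : G := d.trans * d.lin h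

/-- The subgroup `Γ ∩ G` of pure translations in `Γ`, as a subgroup of `G`. -/
def translationSubgroup (Γ : Subgroup (Aff E G)) : Subgroup G :=
  Γ.comap SemidirectProduct.inl

/-- The holonomy group `F = p(Γ)`. -/
abbrev holonomyGroup (Γ : Subgroup (Aff E G)) : Subgroup (LieAut E G) :=
  Γ.map (Aff.proj E G)

/-- The projection `p : Γ → F`. -/
abbrev holonomyProj (Γ : Subgroup (Aff E G)) : Γ →* holonomyGroup Γ :=
  (Aff.proj E G).subgroupMap Γ

/-- `Γ` is almost-crystallographic: `p(Γ)` is finite and `Γ ∩ G` is a discrete and uniform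
(cocompact) subgroup of `G`. -/
structure IsAlmostCrystallographic (Γ : Subgroup (Aff E G)) : Prop where
  finite_holonomy : Finite (holonomyGroup Γ)
  discrete : DiscreteTopology (translationSubgroup Γ)
  uniform : CompactSpace (G ⧸ translationSubgroup Γ)

/-- `Γ` is almost-Bieberbach: almost-crystallographic and torsion-free (the only element of
finite order is the identity). -/
structure IsAlmostBieberbach (Γ : Subgroup (Aff E G)) : Prop
    extends IsAlmostCrystallographic Γ where
  torsion_free : ∀ γ ∈ Γ, IsOfFinOrder γ → γ = 1

/-- The orbit space `Γ\G` with the quotient topology; for almost-Bieberbach `Γ` this is the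
infra-nilmanifold with fundamental group `Γ`. -/
abbrev OrbitSpace (Γ : Subgroup (Aff E G)) : Type _ := Quotient (MulAction.orbitRel Γ G)

/-- The projection `G → Γ\G`. -/
def OrbitSpace.mk (Γ : Subgroup (Aff E G)) (h : G) : OrbitSpace Γ :=
  Quotient.mk (MulAction.orbitRel Γ G) h

/-- The natural projection `Γ₁\G → Γ₂\G`, `Γ₁h ↦ Γ₂h`, for `Γ₁ ≤ Γ₂`. -/
def OrbitSpace.map {Γ₁ Γ₂ : Subgroup (Aff E G)} (hle : Γ₁ ≤ Γ₂) :
    OrbitSpace Γ₁ → OrbitSpace Γ₂ :=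
  Quotient.lift (OrbitSpace.mk Γ₂) (by
    rintro a b ⟨γ, rfl⟩
    exact Quotient.sound ⟨⟨γ.1, hle γ.2⟩, rfl⟩)

/-- `d = (δ, 𝔇)` is an affine homotopy lift of the continuous map `f : Γ\G → Γ\G`: there are a
lift `F : G → G` of `f` and a morphism `φ : Γ → Γ` with `φ(γ) ∘ F = F ∘ γ` (the morphism
determined by the lift) such that also `φ(γ) ∘ (δ, 𝔇) = (δ, 𝔇) ∘ γ`, for all `γ ∈ Γ`. -/
def IsAffineHomotopyLift (Γ : Subgroup (Aff E G)) (f : C(OrbitSpace Γ, OrbitSpace Γ))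
    (d : AffEndo E G) : Prop :=
  ∃ (F : C(G, G)) (φ : Γ →* Γ),
    (∀ h : G, OrbitSpace.mk Γ (F h) = f (OrbitSpace.mk Γ h)) ∧
    (∀ (γ : Γ) (h : G), φ γ • F h = F (γ • h)) ∧
    (∀ (γ : Γ) (h : G), φ γ • d.toFun h = d.toFun (γ • h))

/-- The holonomy representation `ρ : F → GL(𝔤)`, `𝔄 ↦ 𝔄_*`. -/
def holonomyRep (Γ : Subgroup (Aff E G)) :
    Representation ℝ (holonomyGroup Γ) (LieAlg E G) where
  toFun A := lieDifferential E ((A : LieAut E G) : MulAut G).toMonoidHom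
  map_one' := lieDifferential_one E
  map_mul' A B := lieDifferential_mul E
    (f := ((A : LieAut E G) : MulAut G).toMonoidHom)
    (g := ((B : LieAut E G) : MulAut G).toMonoidHom)
    (A : LieAut E G).2.1 (B : LieAut E G).2.1

/-- The differential `𝔇_* : 𝔤 → 𝔤` of the linear part of `(δ, 𝔇)`. -/
def AffEndo.linDifferential (d : AffEndo E G) : Module.End ℝ (LieAlg E G) :=
  lieDifferential E d.lin.toMonoidHom

end Affine

/-! ### The decomposition of a representation induced by a linear map -/

section Decomposition

/-- A decomposition `ρ = ρ_{≤1} ⊕ ρ_{>1}` of the representation `ρ` on `V` induced by the linear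
map `D`: complementary subrepresentations `V_{≤1}`, `V_{>1}` with respect to which `D` has the
block triangular form `(D_{≤1}, *; 0, D_{>1})`, where all complex eigenvalues of `D_{≤1}` have
modulus `≤ 1` and all complex eigenvalues of `D_{>1}` have modulus `> 1`. -/
structure InducedDecomposition {F V : Type*} [Group F] [AddCommGroup V] [Module ℝ V]
    [FiniteDimensional ℝ V] (ρ : Representation ℝ F V) (D : Module.End ℝ V) where
  /-- the subrepresentation `V_{≤1}` -/
  le : Subrepresentation ρ
  /-- the subrepresentation `V_{>1}` -/
  gt : Subrepresentation ρ
  isCompl : IsCompl le.toSubmodule gt.toSubmodule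
  /-- the lower left block of `D` is zero -/
  map_le : ∀ v ∈ le.toSubmodule, D v ∈ le.toSubmodule
  /-- `D_{≤1}` is the restriction of `D` to `V_{≤1}` -/
  eigenvalue_le : ∀ z : ℂ, Polynomial.aeval z (D.restrict map_le).charpoly = 0 → ‖z‖ ≤ 1
  /-- `D_{>1}` is the compression of `D` to `V_{>1}` along `V_{≤1}` -/
  eigenvalue_gt : ∀ z : ℂ, Polynomial.aeval z
    (gt.toSubmodule.projectionOnto le.toSubmodule isCompl.symm ∘ₗ D ∘ₗ
      gt.toSubmodule.subtype).charpoly = 0 → 1 < ‖z‖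

/-- The determinant of `ρ_{>1}(x)` (it is `1` if `V_{>1} = 0`). -/
def InducedDecomposition.detGt {F V : Type*} [Group F] [AddCommGroup V] [Module ℝ V]
    [FiniteDimensional ℝ V] {ρ : Representation ℝ F V} {D : Module.End ℝ V}
    (S : InducedDecomposition ρ D) (x : F) : ℝ :=
  LinearMap.det (S.gt.toRepresentation x)

end Decomposition

end

/-! The equivariance of `(δ, 𝔇)` under `φ` gives, for each `x` in the holonomy group `F`, some `y`
in `F` with `D ρ(x) = ρ(y) D`, where `D = 𝔇_*`. Decomposition: since `F` is finite, iterating a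
choice `x ↦ y` becomes idempotent, so for some `N > 0` each `x` has a `y` with `D ^ N ρ(x) = ρ(y) D
^ N` and `ρ(y)` commuting with `D ^ N`. This makes the sum of the generalized eigenspaces of `D` of
modulus `≤ 1` invariant under `F`; averaging over `F` (Maschke) supplies the complement
(`InducedDecomposition.nonempty`). Lifting: `D_{>1}` is invertible and intertwines `ρ_{>1}(x)` with
`ρ_{>1}(y)`, so their determinants agree (`InducedDecomposition.detGt_eq_of_comm`). Hence `φ`
preserves `Γ_+`, the kernel of a character with values `±1`, and the lift of `f` to `G` descends to
`Γ_+\G`. The covering statements hold because `Γ` acts freely and properly discontinuously. -/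

section

open Polynomial

/-! ### Real polynomials split by the modulus of their roots; iterates of a finite self-map. -/

/-- Two complex roots of an irreducible real polynomial have the same modulus. -/
theorem Irreducible.norm_eq_of_aeval_eq_zero {p : ℝ[X]} (hp : Irreducible p) {z w : ℂ}
    (hz : aeval z p = 0) (hw : aeval w p = 0) : ‖z‖ = ‖w‖ := by
  -- `m` is the real polynomial with roots `z` and its conjugate. As `p` shares the root `z` with
  -- it, `p` divides `m`.
  set m : ℝ[X] := X ^ 2 - C (2 * z.re) * X + C (‖z‖ ^ 2) with hm
  have key : ∀ u : ℂ, aeval u m = (u - z) * (u - (starRingEnd ℂ) z) := by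
    intro u
    have h1 : z + (starRingEnd ℂ) z = 2 * (z.re : ℂ) := by
      rw [Complex.add_conj]; push_cast; ring
    have h2 : z * (starRingEnd ℂ) z = (‖z‖ : ℂ) ^ 2 := Complex.mul_conj' z
    simp only [hm, map_add, map_sub, map_mul, map_pow, aeval_X, aeval_C, Complex.coe_algebraMap]
    push_cast
    linear_combination u * h1 - h2
  have hdvd : p ∣ m := by
    by_contra h
    obtain ⟨a, b, hab⟩ := (hp.coprime_iff_not_dvd).2 h
    have := congrArg (aeval z) hab
    simp [hz, key] at this
  obtain ⟨c, hc⟩ := hdvd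
  have h0 : (w - z) * (w - (starRingEnd ℂ) z) = 0 := by
    rw [← key, hc, map_mul, hw, zero_mul]
  rcases mul_eq_zero.1 h0 with h | h
  · rw [sub_eq_zero.1 h]
  · rw [sub_eq_zero.1 h, RCLike.norm_conj]

/-- A nonzero real polynomial factors into a part with all complex roots in the closed unit disc
and a part with all complex roots outside of it. -/
theorem Polynomial.exists_mul_eq_norm_root_le_one_lt (p : ℝ[X]) (hp : p ≠ 0) :
    ∃ a b : ℝ[X], a * b = p ∧ (∀ z : ℂ, aeval z a = 0 → ‖z‖ ≤ 1) ∧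
      ∀ z : ℂ, aeval z b = 0 → 1 < ‖z‖ := by
  induction p using UniqueFactorizationMonoid.induction_on_prime with
  | h₁ => exact absurd rfl hp
  | h₂ u hu =>
    have hne : ∀ z : ℂ, aeval z u ≠ 0 := fun z => (hu.map (aeval z)).ne_zero
    exact ⟨u, 1, mul_one _, fun z hz => absurd hz (hne z), fun z hz => by simp at hz⟩
  | h₃ q p hq hp' ih =>
    obtain ⟨a, b, rfl, ha, hb⟩ := ih hq
    by_cases h : ∃ z : ℂ, aeval z p = 0 ∧ ‖z‖ ≤ 1
    · obtain ⟨w, hw, hw1⟩ := h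
      refine ⟨p * a, b, mul_assoc _ _ _, fun z hz => ?_, hb⟩
      rw [map_mul, mul_eq_zero] at hz
      rcases hz with hz | hz
      · rwa [hp'.irreducible.norm_eq_of_aeval_eq_zero hz hw]
      · exact ha z hz
    · push Not at h
      refine ⟨a, p * b, by ring, ha, fun z hz => ?_⟩
      rw [map_mul, mul_eq_zero] at hz
      exact hz.elim (h z) (hb z)

/-- Such a `z` is an eigenvalue of the complexification of `T`, where `P(T)` acts on an eigenvector
as the scalar `P(z)`. This turns annihilating polynomials into eigenvalue bounds. -/
theorem LinearMap.aeval_eq_zero_of_aeval_charpoly_eq_zero {V : Type*} [AddCommGroup V] [Module ℝ V]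
    [FiniteDimensional ℝ V] {T : Module.End ℝ V} {P : ℝ[X]} (hP : aeval T P = 0) {z : ℂ}
    (hz : aeval z T.charpoly = 0) : aeval z P = 0 := by
  have h1 : (T.baseChange ℂ).charpoly.IsRoot z := by
    rw [LinearMap.charpoly_baseChange, IsRoot, eval_map_algebraMap, hz]
  rw [← Module.End.hasEigenvalue_iff_isRoot_charpoly] at h1
  obtain ⟨v, hv⟩ := h1.exists_hasEigenvector
  have h2 : aeval (T.baseChange ℂ) (P.map (algebraMap ℝ ℂ)) = 0 := by
    have : aeval (Module.End.baseChangeHom ℝ ℂ V T) P = Module.End.baseChangeHom ℝ ℂ V (aeval T P) :=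
      aeval_algHom_apply _ _ _
    rw [aeval_map_algebraMap]
    exact this.trans (by rw [hP, map_zero])
  have h3 := Module.End.aeval_apply_of_hasEigenvector (p := P.map (algebraMap ℝ ℂ)) hv
  rw [h2, eval_map_algebraMap] at h3
  exact (smul_eq_zero.1 h3.symm).resolve_right hv.2

/-- A linear map that intertwines two endomorphisms intertwines every polynomial in them. -/
theorem LinearMap.map_aeval_apply_of_intertwines {V W : Type*} [AddCommGroup V] [Module ℝ V]
    [AddCommGroup W] [Module ℝ W] {L : V →ₗ[ℝ] W} {A : Module.End ℝ V} {B : Module.End ℝ W}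
    (h : ∀ v, L (A v) = B (L v)) (Q : ℝ[X]) (v : V) : L (aeval A Q v) = aeval B Q (L v) := by
  induction Q using Polynomial.induction_on' with
  | add p q hp hq => simp [hp, hq]
  | monomial n c =>
    have : ∀ n : ℕ, L ((A ^ n) v) = (B ^ n) (L v) := by
      intro n
      induction n with
      | zero => rfl
      | succ n ih => rw [pow_succ', pow_succ', Module.End.mul_apply, h, ih, Module.End.mul_apply]
    simp [aeval_monomial, this]

/-- Some positive iterate of a self-map of a finite type is idempotent. -/
theorem Function.exists_iterate_idempotent {α : Type*} [Finite α] (s : α → α) :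
    ∃ N, 0 < N ∧ ∀ x, s^[N] (s^[N] x) = s^[N] x := by
  obtain ⟨i, j, hij, h⟩ := Finite.exists_ne_map_eq_of_infinite (fun n : ℕ => s^[n])
  wlog hlt : i < j generalizing i j
  · exact this j i hij.symm h.symm (lt_of_le_of_ne (not_lt.1 hlt) hij.symm)
  obtain ⟨q, rfl⟩ := Nat.exists_eq_add_of_lt hlt
  have hper : ∀ n, i ≤ n → ∀ k, s^[n + k * (q + 1)] = s^[n] := by
    intro n hn k
    induction k with
    | zero => simp
    | succ k ih =>
      obtain ⟨m, rfl⟩ := Nat.exists_eq_add_of_le hn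
      rw [← ih, show i + m + (k + 1) * (q + 1) = (m + k * (q + 1)) + (i + q + 1) by ring,
        show i + m + k * (q + 1) = (m + k * (q + 1)) + i by ring, Function.iterate_add,
        Function.iterate_add s _ i]
      exact congrArg _ h.symm
  -- This exponent is a multiple of the period `q + 1`, at least the preperiod `i`, and positive
  -- even when `i = 0`.
  refine ⟨(i + 1) * (q + 1), by positivity, fun x => ?_⟩
  rw [← Function.iterate_add_apply]
  exact congrFun (hper ((i + 1) * (q + 1)) (by nlinarith) (i + 1)) x

/-! ### The decomposition induced by `D` and the determinant of `ρ_{>1}`. -/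

section

variable {F V : Type*} [Group F] [AddCommGroup V] [Module ℝ V]

theorem Representation.exists_pow_comp_eq [Finite F] {ρ : Representation ℝ F V}
    {D : Module.End ℝ V} (h : ∀ x, ∃ y, D * ρ x = ρ y * D) :
    ∃ N, 0 < N ∧ ∀ x, ∃ y, D ^ N * ρ x = ρ y * D ^ N ∧ D ^ N * ρ y = ρ y * D ^ N := by
  choose s hs using h
  have hpow : ∀ n x, D ^ n * ρ x = ρ (s^[n] x) * D ^ n := by
    intro n
    induction n with
    | zero => simp
    | succ n ih =>
      intro x
      rw [pow_succ, mul_assoc, hs, ← mul_assoc, ih, mul_assoc, Function.iterate_succ_apply]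
  obtain ⟨N, hN, hidem⟩ := Function.exists_iterate_idempotent s
  exact ⟨N, hN, fun x => ⟨s^[N] x, hpow N x, by rw [hpow N, hidem]⟩⟩

theorem Subrepresentation.exists_isCompl [Finite F] {ρ : Representation ℝ F V}
    (W : Subrepresentation ρ) :
    ∃ U : Subrepresentation ρ, IsCompl W.toSubmodule U.toSubmodule := by
  have : NeZero (Nat.card F : ℝ) := ⟨by exact_mod_cast Nat.card_pos.ne'⟩
  obtain ⟨U, hU⟩ := MonoidAlgebra.Submodule.exists_isCompl (Subrepresentation.asSubmodule W)
  refine ⟨Subrepresentation.ofSubmodule' U, ?_⟩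
  have h := (Subrepresentation.subrepresentationSubmoduleOrderIso (ρ := ρ)).symm.isCompl hU
  refine ⟨disjoint_iff.2 ?_, codisjoint_iff.2 ?_⟩
  · exact congrArg Subrepresentation.toSubmodule (disjoint_iff.1 h.1)
  · exact congrArg Subrepresentation.toSubmodule (codisjoint_iff.1 h.2)

/-- Under `U ≃ V ⧸ W` the compression is the map induced by `D` on the quotient, so a polynomial in
`D` with image in `W` vanishes there. -/
theorem Submodule.aeval_comp_projectionOnto_eq_zero {W U : Submodule ℝ V} (hc : IsCompl U W)
    {D : Module.End ℝ V} (hD : ∀ v ∈ W, D v ∈ W) {P : ℝ[X]} (hP : ∀ v, aeval D P v ∈ W) :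
    aeval (U.projectionOnto W hc ∘ₗ D ∘ₗ U.subtype) P = 0 := by
  set T : Module.End ℝ U := U.projectionOnto W hc ∘ₗ D ∘ₗ U.subtype with hT
  have h1 : ∀ v, U.projectionOnto W hc (D v) = T (U.projectionOnto W hc v) := by
    intro v
    have hv : v - U.projectionOnto W hc v ∈ W := by
      rw [← Submodule.projectionOnto_apply_eq_zero_iff hc, map_sub,
        Submodule.projectionOnto_apply_left, sub_self]
    have := (Submodule.projectionOnto_apply_eq_zero_iff hc).2 (hD _ hv)
    rw [map_sub, map_sub, sub_eq_zero] at this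
    exact this
  ext u : 1
  have := LinearMap.map_aeval_apply_of_intertwines h1 P u
  rw [Submodule.projectionOnto_apply_left] at this
  rw [← this]
  exact (Submodule.projectionOnto_apply_eq_zero_iff hc).2 (hP _)

variable [FiniteDimensional ℝ V]

theorem InducedDecomposition.nonempty [Finite F] {ρ : Representation ℝ F V}
    {D : Module.End ℝ V} (h : ∀ x, ∃ y, D * ρ x = ρ y * D) :
    Nonempty (InducedDecomposition ρ D) := by
  obtain ⟨N, hN, hcomm⟩ := Representation.exists_pow_comp_eq h
  -- The extra factor `X` forces `X ∣ a`, even when `D` is invertible. Then `a(D ^ N)` ends in a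
  -- factor `D ^ N`, which is what carries `ρ x` to the `ρ y` commuting with `D ^ N`.
  obtain ⟨a, b, hab, ha, hb⟩ := Polynomial.exists_mul_eq_norm_root_le_one_lt
    (X * (D ^ N).charpoly) (mul_ne_zero X_ne_zero (D ^ N).charpoly_monic.ne_zero)
  have hXa : X ∣ a := by
    have h0 : aeval (0 : ℂ) a * aeval (0 : ℂ) b = 0 := by rw [← map_mul, hab]; simp
    rcases mul_eq_zero.1 h0 with h0 | h0
    · rw [X_dvd_iff, coeff_zero_eq_aeval_zero]
      have : aeval (0 : ℂ) a = algebraMap ℝ ℂ (aeval (0 : ℝ) a) := by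
        rw [← aeval_algebraMap_apply, map_zero]
      rw [this] at h0
      simpa using h0
    · have := hb 0 h0
      simp at this
      linarith
  obtain ⟨a', ha'⟩ := hXa
  have hexp : ∀ (A : Module.End ℝ V) (Q : ℝ[X]), aeval A (Q.comp (X ^ N)) = aeval (A ^ N) Q := by
    intro A Q; simp [aeval_comp]
  let W : Subrepresentation ρ :=
    { toSubmodule := LinearMap.ker (aeval (D ^ N) a)
      apply_mem_toSubmodule := by
        intro x v hv
        obtain ⟨y, h1, h2⟩ := hcomm x
        have h3 : ∀ w, ρ y (aeval (D ^ N) a' w) = aeval (D ^ N) a' (ρ y w) :=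
          LinearMap.map_aeval_apply_of_intertwines (fun w => (LinearMap.congr_fun h2 w).symm) a'
        have h4 : aeval (D ^ N) a = aeval (D ^ N) a' * D ^ N := by
          rw [ha', mul_comm, map_mul, aeval_X]
        rw [LinearMap.mem_ker, h4, Module.End.mul_apply] at hv ⊢
        rw [show (D ^ N) (ρ x v) = ρ y ((D ^ N) v) from LinearMap.congr_fun h1 v, ← h3, hv,
          map_zero] }
  have hmap : ∀ v ∈ W.toSubmodule, D v ∈ W.toSubmodule := by
    intro v hv
    have hv' : aeval (D ^ N) a v = 0 := hv
    change aeval (D ^ N) a (D v) = 0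
    rw [← hexp] at hv' ⊢
    rw [← LinearMap.map_aeval_apply_of_intertwines (fun _ => rfl), hv', map_zero]
  obtain ⟨U, hU⟩ := W.exists_isCompl
  refine ⟨⟨W, U, hU, hmap, fun z hz => ?_, fun z hz => ?_⟩⟩
  · have h0 : aeval (D.restrict hmap) (a.comp (X ^ N)) = 0 := by
      ext v
      have : ((aeval (D.restrict hmap) (a.comp (X ^ N)) v : W.toSubmodule) : V) =
          aeval D (a.comp (X ^ N)) v :=
        LinearMap.map_aeval_apply_of_intertwines (L := W.toSubmodule.subtype) (fun _ => rfl) _ v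
      rw [this, hexp]
      exact v.2
    have := LinearMap.aeval_eq_zero_of_aeval_charpoly_eq_zero h0 hz
    rw [aeval_comp, map_pow, aeval_X] at this
    have := ha _ this
    rw [norm_pow] at this
    exact (pow_le_one_iff_of_nonneg (norm_nonneg _) hN.ne').1 this
  -- By Cayley–Hamilton `a(D ^ N) b(D ^ N) = 0`, so `b(D ^ N)` maps into `W`.
  · have h0 := Submodule.aeval_comp_projectionOnto_eq_zero (P := b.comp (X ^ N)) hU.symm hmap (by
      intro v
      rw [hexp]
      change aeval (D ^ N) a (aeval (D ^ N) b v) = 0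
      rw [← Module.End.mul_apply, ← map_mul, hab, map_mul, LinearMap.aeval_self_charpoly, mul_zero]
      rfl)
    have := LinearMap.aeval_eq_zero_of_aeval_charpoly_eq_zero h0 hz
    rw [aeval_comp, map_pow, aeval_X] at this
    have := hb _ this
    rw [norm_pow] at this
    exact (one_lt_pow_iff_of_nonneg (norm_nonneg _) hN.ne').1 this

theorem InducedDecomposition.detGt_eq_of_comm {ρ : Representation ℝ F V}
    {D : Module.End ℝ V} (S : InducedDecomposition ρ D) {x y : F} (h : D * ρ x = ρ y * D) :
    S.detGt x = S.detGt y := by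
  set T : Module.End ℝ S.gt.toSubmodule :=
    S.gt.toSubmodule.projectionOnto S.le.toSubmodule S.isCompl.symm ∘ₗ D ∘ₗ
      S.gt.toSubmodule.subtype with hT
  -- Zero is not an eigenvalue of `T`, since it does not have modulus `> 1`.
  have hdet : LinearMap.det T ≠ 0 := by
    intro h0
    have hc : T.charpoly.coeff 0 = 0 := by
      rw [LinearMap.det_eq_sign_charpoly_coeff] at h0
      exact (mul_eq_zero.1 h0).resolve_left (by simp)
    have := S.eigenvalue_gt 0 (by
      have : aeval (0 : ℂ) T.charpoly = algebraMap ℝ ℂ (aeval (0 : ℝ) T.charpoly) := by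
        rw [← aeval_algebraMap_apply, map_zero]
      rw [← hT, this, ← coeff_zero_eq_aeval_zero, hc, map_zero])
    simp at this
    linarith
  have hcomm : T * S.gt.toRepresentation x = S.gt.toRepresentation y * T := by
    ext u : 1
    have hu : (D (ρ x u) : V) = ρ y (D u) := LinearMap.congr_fun h u
    -- `D u` and `T u` agree modulo `V_{≤1}`, which `ρ y` preserves; hence `ρ y` respects the
    -- compression.
    have hdec : D u - T u ∈ S.le.toSubmodule := by
      rw [← Submodule.projectionOnto_apply_eq_zero_iff S.isCompl.symm, map_sub,
        Submodule.projectionOnto_apply_left, sub_eq_zero]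
      rfl
    have h1 := (Submodule.projectionOnto_apply_eq_zero_iff S.isCompl.symm).2
      (S.le.apply_mem_toSubmodule y hdec)
    rw [map_sub, map_sub, sub_eq_zero, ← hu] at h1
    refine Eq.trans (b := S.gt.toSubmodule.projectionOnto S.le.toSubmodule S.isCompl.symm
      (D (ρ x u))) rfl (h1.trans ?_)
    exact Submodule.projectionOnto_apply_left S.isCompl.symm (S.gt.toRepresentation y (T u))
  have := congrArg LinearMap.det hcomm
  rw [map_mul, map_mul, mul_comm] at this
  exact mul_right_cancel₀ hdet this

/-- The character `det ρ_{>1}`. -/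
noncomputable def InducedDecomposition.detGtHom {ρ : Representation ℝ F V}
    {D : Module.End ℝ V} (S : InducedDecomposition ρ D) : F →* ℝ :=
  LinearMap.det.comp S.gt.toRepresentation

theorem InducedDecomposition.detGtHom_apply {ρ : Representation ℝ F V}
    {D : Module.End ℝ V} (S : InducedDecomposition ρ D) (x : F) : S.detGtHom x = S.detGt x := rfl

end

theorem MonoidHom.eq_one_or_neg_one_of_finite {F : Type*} [Group F] [Finite F] (χ : F →* ℝ) (x : F) :
    χ x = 1 ∨ χ x = -1 := by
  have h : |χ x| = 1 := by
    refine (pow_eq_one_iff_of_nonneg (abs_nonneg _) (Nat.card_pos (α := F)).ne').1 ?_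
    rw [← abs_pow, ← map_pow, pow_card_eq_one', map_one, abs_one]
  exact eq_or_eq_neg_of_abs_eq h

theorem MonoidHom.index_ker_eq_one_or_two {H : Type*} [Group H] (χ : H →* ℝ)
    (h : ∀ x, χ x = 1 ∨ χ x = -1) : χ.ker.index = 1 ∨ χ.ker.index = 2 := by
  by_cases h1 : ∀ x, χ x = 1
  · left
    rw [Subgroup.index_eq_one, Subgroup.eq_top_iff']
    exact h1
  · right
    push Not at h1
    obtain ⟨a, ha⟩ := h1
    have ha' := (h a).resolve_left ha
    rw [Subgroup.index_eq_two_iff]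
    refine ⟨a, fun b => ?_⟩
    simp only [MonoidHom.mem_ker, map_mul, ha']
    rcases h b with hb | hb <;> norm_num [hb, Xor]

end

/-! ### Affine maps, their linear parts, and the topology of the orbit spaces. -/

section

variable {E : Type*} [NormedAddCommGroup E] [NormedSpace ℝ E]
  {G : Type*} [TopologicalSpace G] [ChartedSpace E G] [Group G]

theorem Aff.smul_def (a : Aff E G) (h : G) : a • h = a.left * (a.right : MulAut G) h := rfl

instance Aff.instContinuousConstSMul [IsTopologicalGroup G] : ContinuousConstSMul (Aff E G) G where
  continuous_const_smul a := continuous_const.mul a.right.2.1.continuous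

instance Aff.instContinuousConstSMulSubgroup [IsTopologicalGroup G] (Γ : Subgroup (Aff E G)) :
    ContinuousConstSMul Γ G where
  continuous_const_smul γ := continuous_const_smul (γ : Aff E G)

/-- A map that semiconjugates `a` to `b` in the affine group has linear part that semiconjugates
the linear parts. -/
theorem AffEndo.lin_comp_of_semiconj {d : AffEndo E G} {a b : Aff E G}
    (h : ∀ x : G, b • d.toFun x = d.toFun (a • x)) (x : G) :
    d.lin ((a.right : MulAut G) x) = (b.right : MulAut G) (d.lin x) := by
  -- Evaluation at `1` isolates the translational parts, which then cancel from the identity at `x`.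
  have h1 := h 1
  have hx := h x
  simp only [Aff.smul_def, AffEndo.toFun, map_mul, map_one, mul_one] at h1 hx
  rw [← mul_assoc, h1, ← mul_assoc] at hx
  exact (mul_left_cancel hx).symm

theorem AffEndo.linDifferential_mul_holonomyRep {Γ : Subgroup (Aff E G)} {d : AffEndo E G}
    {γ γ' : Γ} (h : ∀ x : G, γ' • d.toFun x = d.toFun (γ • x)) :
    d.linDifferential * holonomyRep Γ (holonomyProj Γ γ) =
      holonomyRep Γ (holonomyProj Γ γ') * d.linDifferential := by
  have hcomp : d.lin.toMonoidHom.comp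
      ((holonomyProj Γ γ : LieAut E G) : MulAut G).toMonoidHom =
      ((holonomyProj Γ γ' : LieAut E G) : MulAut G).toMonoidHom.comp d.lin.toMonoidHom :=
    MonoidHom.ext fun x => AffEndo.lin_comp_of_semiconj (a := (γ : Aff E G)) (b := (γ' : Aff E G)) h x
  have h1 := lieDifferential_mul E (f := d.lin.toMonoidHom)
    (g := ((holonomyProj Γ γ : LieAut E G) : MulAut G).toMonoidHom)
    d.lin.contMDiff_toFun (holonomyProj Γ γ : LieAut E G).2.1
  have h2 := lieDifferential_mul E
    (f := ((holonomyProj Γ γ' : LieAut E G) : MulAut G).toMonoidHom) (g := d.lin.toMonoidHom)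
    (holonomyProj Γ γ' : LieAut E G).2.1 d.lin.contMDiff_toFun
  rw [hcomp] at h1
  exact h1.symm.trans h2

theorem translationSubgroup_eq_of_le {Γ₁ Γ₂ : Subgroup (Aff E G)} (hle : Γ₁ ≤ Γ₂)
    (h : ∀ γ ∈ Γ₂, Aff.proj E G γ = 1 → γ ∈ Γ₁) :
    translationSubgroup Γ₁ = translationSubgroup Γ₂ :=
  le_antisymm (Subgroup.comap_mono hle) fun _ hg => h _ hg (SemidirectProduct.rightHom_inl _)

/-- A subgroup of an almost-Bieberbach group that has the same translations is
almost-Bieberbach. -/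
theorem IsAlmostBieberbach.of_le {Γ₁ Γ₂ : Subgroup (Aff E G)} (hΓ : IsAlmostBieberbach Γ₂)
    (hle : Γ₁ ≤ Γ₂) (h : ∀ γ ∈ Γ₂, Aff.proj E G γ = 1 → γ ∈ Γ₁) : IsAlmostBieberbach Γ₁ where
  finite_holonomy := by
    have := hΓ.finite_holonomy
    exact Finite.Set.subset (holonomyGroup Γ₂ : Set (LieAut E G)) (Subgroup.map_mono hle)
  discrete := by
    rw [translationSubgroup_eq_of_le hle h]
    exact hΓ.discrete
  uniform := by
    rw [translationSubgroup_eq_of_le hle h]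
    exact hΓ.uniform
  torsion_free γ hγ := hΓ.torsion_free γ (hle hγ)

theorem OrbitSpace.mk_eq_mk_iff {Γ : Subgroup (Aff E G)} {x y : G} :
    OrbitSpace.mk Γ x = OrbitSpace.mk Γ y ↔ ∃ γ : Γ, γ • y = x :=
  Quotient.eq''

theorem OrbitSpace.continuous_mk (Γ : Subgroup (Aff E G)) : Continuous (OrbitSpace.mk Γ) :=
  continuous_quot_mk

theorem OrbitSpace.surjective_mk (Γ : Subgroup (Aff E G)) : Function.Surjective (OrbitSpace.mk Γ) :=
  Quot.mk_surjective

theorem OrbitSpace.compactSpace [IsTopologicalGroup G] {Γ : Subgroup (Aff E G)}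
    (hΓ : CompactSpace (G ⧸ translationSubgroup Γ)) : CompactSpace (OrbitSpace Γ) := by
  -- Inversion is needed because `G ⧸ L` consists of left cosets `gL`, while translations in `Γ` act
  -- from the left with orbits `Lg`.
  let q : G ⧸ translationSubgroup Γ → OrbitSpace Γ :=
    Quotient.lift (fun g : G => OrbitSpace.mk Γ g⁻¹) (by
      intro a b hab
      have hab' : a⁻¹ * b ∈ translationSubgroup Γ := QuotientGroup.leftRel_apply.1 hab
      refine OrbitSpace.mk_eq_mk_iff.2 ⟨⟨SemidirectProduct.inl (a⁻¹ * b), hab'⟩, ?_⟩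
      change (SemidirectProduct.inl (a⁻¹ * b) : Aff E G) • b⁻¹ = a⁻¹
      simp [Aff.smul_def])
  have hq : Continuous q := by
    refine continuous_quot_lift _ ?_
    exact (OrbitSpace.continuous_mk Γ).comp continuous_inv
  have hs : Function.Surjective q := by
    intro y
    obtain ⟨g, rfl⟩ := OrbitSpace.surjective_mk Γ y
    exact ⟨QuotientGroup.mk g⁻¹, congrArg (OrbitSpace.mk Γ) (inv_inv g)⟩
  exact hs.compactSpace hq

variable [T2Space G]

/-- A discrete subgroup acts properly discontinuously by translations, and the translations have
finite index in `Γ` because the holonomy is finite. -/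
theorem IsAlmostCrystallographic.properlyDiscontinuousSMul [IsTopologicalGroup G]
    {Γ : Subgroup (Aff E G)}
    (hΓ : IsAlmostCrystallographic Γ) : ProperlyDiscontinuousSMul Γ G := by
  have := hΓ.finite_holonomy
  have hL : ProperlyDiscontinuousSMul (translationSubgroup Γ) G :=
    Subgroup.properlyDiscontinuousSMul_of_tendsto_cofinite _
      (Subgroup.tendsto_coe_cofinite_of_discrete _ ⟨hΓ.discrete⟩)
  have hH : ProperlyDiscontinuousSMul ↥((Aff.proj E G).ker ⊓ Γ) G := by
    rw [Subgroup.properlyDiscontinuousSMul_iff] at hL ⊢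
    intro K L hK hL'
    refine ((hL hK hL').image (SemidirectProduct.inl : G → Aff E G)).subset ?_
    rintro γ ⟨⟨hγ1, hγ⟩, hne⟩
    have hγ' : SemidirectProduct.inl γ.left = γ := by
      ext1
      · simp
      · exact (show γ.right = 1 from hγ1).symm
    refine ⟨γ.left, ⟨?_, ?_⟩, hγ'⟩
    · change SemidirectProduct.inl γ.left ∈ Γ
      rwa [hγ']
    · obtain ⟨_, ⟨x, hx, rfl⟩, hxL⟩ := hne
      refine ⟨_, ⟨x, hx, rfl⟩, ?_⟩
      rw [← hγ'] at hxL
      simpa [Aff.smul_def] using hxL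
  have hfin : ((Aff.proj E G).ker ⊓ Γ).IsFiniteRelIndex Γ := by
    refine ⟨?_⟩
    rw [Subgroup.inf_relIndex_right, Subgroup.relIndex_ker]
    exact Nat.card_pos.ne'
  exact ProperlyDiscontinuousSMul.ofFiniteRelIndex Γ ((Aff.proj E G).ker ⊓ Γ)

/-- An almost-Bieberbach group acts freely. -/
theorem IsAlmostBieberbach.eq_one_of_smul_eq [IsTopologicalGroup G] {Γ : Subgroup (Aff E G)}
    (hΓ : IsAlmostBieberbach Γ) {γ : Γ} {x : G} (h : γ • x = x) : γ = 1 := by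
  have := hΓ.properlyDiscontinuousSMul
  -- Stabilizers are finite by proper discontinuity, hence trivial by torsion-freeness.
  have hfin : Finite (MulAction.stabilizer Γ x) := ProperlyDiscontinuousSMul.finite_stabilizer x
  have h1 : IsOfFinOrder (⟨γ, h⟩ : MulAction.stabilizer Γ x) := isOfFinOrder_of_finite _
  have h2 := ((MulAction.stabilizer Γ x).subtype.isOfFinOrder h1)
  exact Subtype.ext (hΓ.torsion_free _ γ.2 (Γ.subtype.isOfFinOrder h2))

theorem OrbitSpace.isLocalHomeomorph_mk [IsTopologicalGroup G] [LocallyCompactSpace G]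
    {Γ : Subgroup (Aff E G)} (hΓ : IsAlmostBieberbach Γ) : IsLocalHomeomorph (OrbitSpace.mk Γ) := by
  have := hΓ.properlyDiscontinuousSMul
  have : IsCancelSMul Γ G :=
    isCancelSMul_iff_eq_one_of_smul_eq.2 fun _ _ h => hΓ.eq_one_of_smul_eq h
  have h : IsQuotientCoveringMap (OrbitSpace.mk Γ) Γ :=
    isQuotientCoveringMap_quotientMk_of_properlyDiscontinuousSMul
  exact h.isCoveringMap.isLocalHomeomorph

theorem OrbitSpace.isCoveringMap_map [IsTopologicalGroup G] [LocallyCompactSpace G]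
    {Γ₁ Γ₂ : Subgroup (Aff E G)} (hΓ₁ : IsAlmostBieberbach Γ₁) (hΓ₂ : IsAlmostBieberbach Γ₂)
    (hle : Γ₁ ≤ Γ₂) : IsCoveringMap (OrbitSpace.map hle) := by
  have := hΓ₁.properlyDiscontinuousSMul
  have := hΓ₂.properlyDiscontinuousSMul
  have := OrbitSpace.compactSpace hΓ₁.uniform
  -- The orbit spaces are Hausdorff and the source is compact, so a local homeomorphism suffices;
  -- this follows by cancelling the local homeomorphism `G → Γ₁\G`.
  rw [← isLocalHomeomorph_iff_isCoveringMap, isLocalHomeomorph_iff_isLocalHomeomorphOn_univ,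
    ← (OrbitSpace.surjective_mk Γ₁).range_eq, ← Set.image_univ]
  exact IsLocalHomeomorphOn.of_comp_right
    (OrbitSpace.isLocalHomeomorph_mk hΓ₂).isLocalHomeomorphOn
    (OrbitSpace.isLocalHomeomorph_mk hΓ₁).isLocalHomeomorphOn

theorem OrbitSpace.ncard_fiber_map_eq_two [IsTopologicalGroup G]
    {Γ₁ Γ₂ : Subgroup (Aff E G)} (hΓ₂ : IsAlmostBieberbach Γ₂)
    (hle : Γ₁ ≤ Γ₂) (hindex : (Γ₁.subgroupOf Γ₂).index = 2) (x : OrbitSpace Γ₂) :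
    (OrbitSpace.map hle ⁻¹' {x}).ncard = 2 := by
  obtain ⟨g, rfl⟩ := OrbitSpace.surjective_mk Γ₂ x
  obtain ⟨a, ha⟩ := Subgroup.index_eq_two_iff.1 hindex
  have ha' : a ∉ Γ₁.subgroupOf Γ₂ := by
    have h := ha 1
    rw [one_mul] at h
    exact fun h' => (h.elim (fun h => h.2 (one_mem _)) fun h => h.2 h')
  rw [Set.ncard_eq_two]
  -- The two points correspond to the two cosets of `Γ₁` in `Γ₂`; freeness of the action keeps them
  -- distinct.
  refine ⟨OrbitSpace.mk Γ₁ g, OrbitSpace.mk Γ₁ (a⁻¹ • g), ?_, ?_⟩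
  · intro h
    obtain ⟨γ, hγ⟩ := OrbitSpace.mk_eq_mk_iff.1 h
    have h1 : ((⟨γ, hle γ.2⟩ : Γ₂) * a⁻¹) • g = g := by rw [mul_smul]; exact hγ
    have h2 := hΓ₂.eq_one_of_smul_eq h1
    rw [mul_inv_eq_one] at h2
    exact ha' (h2 ▸ γ.2)
  · ext y
    obtain ⟨h, rfl⟩ := OrbitSpace.surjective_mk Γ₁ y
    simp only [Set.mem_preimage, Set.mem_singleton_iff, Set.mem_insert_iff]
    constructor
    · intro hy
      obtain ⟨γ, rfl⟩ := OrbitSpace.mk_eq_mk_iff.1 (show OrbitSpace.mk Γ₂ h = _ from hy)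
      by_cases hγ : γ ∈ Γ₁.subgroupOf Γ₂
      · exact Or.inl (OrbitSpace.mk_eq_mk_iff.2 ⟨⟨γ, hγ⟩, rfl⟩)
      · have hγa : γ * a ∈ Γ₁.subgroupOf Γ₂ := ((ha γ).resolve_right fun h => hγ h.1).1
        refine Or.inr (OrbitSpace.mk_eq_mk_iff.2 ⟨⟨γ * a, hγa⟩, ?_⟩)
        change (γ * a) • a⁻¹ • g = γ • g
        rw [mul_smul, smul_inv_smul]
    · rintro (hy | hy)
      · rw [hy]; rfl
      · rw [hy]
        exact OrbitSpace.mk_eq_mk_iff.2 ⟨a⁻¹, rfl⟩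

omit [T2Space G]

/-- The lift of a self-map of `Γ₂\G` to `Γ₁\G`, if the induced morphism preserves `Γ₁`. -/
theorem IsAffineHomotopyLift.exists_lift {Γ₁ Γ₂ : Subgroup (Aff E G)} (hle : Γ₁ ≤ Γ₂)
    {f : C(OrbitSpace Γ₂, OrbitSpace Γ₂)} {d : AffEndo E G} {F : C(G, G)} {φ : Γ₂ →* Γ₂}
    (hF : ∀ h : G, OrbitSpace.mk Γ₂ (F h) = f (OrbitSpace.mk Γ₂ h))
    (hφF : ∀ (γ : Γ₂) (h : G), φ γ • F h = F (γ • h))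
    (hφd : ∀ (γ : Γ₂) (h : G), φ γ • d.toFun h = d.toFun (γ • h))
    (hφ : ∀ γ : Γ₂, (γ : Aff E G) ∈ Γ₁ → (φ γ : Aff E G) ∈ Γ₁) :
    ∃ fp : C(OrbitSpace Γ₁, OrbitSpace Γ₁),
      (∀ y : OrbitSpace Γ₁, OrbitSpace.map hle (fp y) = f (OrbitSpace.map hle y)) ∧
      IsAffineHomotopyLift Γ₁ fp d := by
  let ψ : Γ₁ →* Γ₁ :=
    (Γ₂.subtype.comp (φ.comp (Subgroup.inclusion hle))).codRestrict Γ₁ fun γ => hφ _ γ.2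
  have hψ : ∀ (γ : Γ₁) (h : G), ψ γ • F h = F (γ • h) := fun γ h =>
    hφF (Subgroup.inclusion hle γ) h
  let fp : C(OrbitSpace Γ₁, OrbitSpace Γ₁) :=
    { toFun := Quotient.lift (fun h => OrbitSpace.mk Γ₁ (F h)) (by
        rintro _ b ⟨γ, rfl⟩
        exact OrbitSpace.mk_eq_mk_iff.2 ⟨ψ γ, hψ γ b⟩)
      continuous_toFun := continuous_quot_lift _ ((OrbitSpace.continuous_mk Γ₁).comp F.continuous) }
  refine ⟨fp, fun y => ?_, F, ψ, fun h => rfl, hψ, fun γ h => hφd (Subgroup.inclusion hle γ) h⟩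
  obtain ⟨h, rfl⟩ := OrbitSpace.surjective_mk Γ₁ y
  exact hF h

end

theorem theorem4p1
    {E : Type*} [NormedAddCommGroup E] [NormedSpace ℝ E] [FiniteDimensional ℝ E]
    {G : Type*} [TopologicalSpace G] [T2Space G] [ChartedSpace E G] [Group G]
    [LieGroup 𝓘(ℝ, E) ∞ G] [ConnectedSpace G] [SimplyConnectedSpace G] [Group.IsNilpotent G]
    (Γ : Subgroup (Aff E G)) (hΓ : IsAlmostBieberbach Γ)
    (f : C(OrbitSpace Γ, OrbitSpace Γ)) (d : AffEndo E G)
    (hd : IsAffineHomotopyLift Γ f d) :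
    Nonempty (InducedDecomposition (holonomyRep Γ) d.linDifferential) ∧
    ∀ S : InducedDecomposition (holonomyRep Γ) d.linDifferential,
      ∃ (Γp : Subgroup (Aff E G)) (hle : Γp ≤ Γ),
        (∀ γ : Γ, (γ : Aff E G) ∈ Γp ↔ S.detGt (holonomyProj Γ γ) = 1) ∧
        (Γp.subgroupOf Γ).Normal ∧
        ((Γp.subgroupOf Γ).index = 1 ∨ (Γp.subgroupOf Γ).index = 2) ∧
        IsAlmostBieberbach Γp ∧
        (Γp = Γ ∨
          ((Γp.subgroupOf Γ).index = 2 ∧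
            IsCoveringMap (OrbitSpace.map hle) ∧
            (∀ x : OrbitSpace Γ, (OrbitSpace.map hle ⁻¹' {x}).ncard = 2) ∧
            ∃ fp : C(OrbitSpace Γp, OrbitSpace Γp),
              (∀ y : OrbitSpace Γp, OrbitSpace.map hle (fp y) = f (OrbitSpace.map hle y)) ∧
              IsAffineHomotopyLift Γp fp d)) := by
  have : IsTopologicalGroup G := topologicalGroup_of_lieGroup 𝓘(ℝ, E) ∞
  have : LocallyCompactSpace G := ChartedSpace.locallyCompactSpace E G
  have := hΓ.finite_holonomy
  obtain ⟨F, φ, hF, hφF, hφd⟩ := hd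
  have hcomm : ∀ γ : Γ, d.linDifferential * holonomyRep Γ (holonomyProj Γ γ) =
      holonomyRep Γ (holonomyProj Γ (φ γ)) * d.linDifferential := fun γ =>
    AffEndo.linDifferential_mul_holonomyRep (hφd γ)
  refine ⟨InducedDecomposition.nonempty fun x => ?_, fun S => ?_⟩
  · obtain ⟨γ, rfl⟩ := (Aff.proj E G).subgroupMap_surjective Γ x
    exact ⟨_, hcomm γ⟩
  let χ : Γ →* ℝ := S.detGtHom.comp (holonomyProj Γ)
  have hmem : ∀ γ : Γ, (γ : Aff E G) ∈ χ.ker.map Γ.subtype ↔ S.detGt (holonomyProj Γ γ) = 1 :=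
    fun γ => (Subgroup.mem_map_iff_mem Γ.subtype_injective).trans MonoidHom.mem_ker
  have hle : χ.ker.map Γ.subtype ≤ Γ := Subgroup.map_subtype_le _
  have hsub : (χ.ker.map Γ.subtype).subgroupOf Γ = χ.ker :=
    Subgroup.comap_map_eq_self_of_injective Γ.subtype_injective _
  have hindex := χ.index_ker_eq_one_or_two fun γ =>
    S.detGtHom.eq_one_or_neg_one_of_finite (holonomyProj Γ γ)
  have hΓp : IsAlmostBieberbach (χ.ker.map Γ.subtype) := hΓ.of_le hle fun γ hγ h1 => by
    refine (hmem ⟨γ, hγ⟩).2 ?_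
    rw [show holonomyProj Γ ⟨γ, hγ⟩ = 1 from Subtype.ext h1, ← S.detGtHom_apply, map_one]
  refine ⟨χ.ker.map Γ.subtype, hle, hmem, ?_, ?_, hΓp, ?_⟩
  · rw [hsub]
    infer_instance
  · rwa [hsub]
  · rcases hindex with h1 | h2
    · left
      rw [Subgroup.index_eq_one] at h1
      rw [h1, ← MonoidHom.range_eq_map, Subgroup.range_subtype]
    · right
      rw [← hsub] at h2
      refine ⟨h2, OrbitSpace.isCoveringMap_map hΓp hΓ hle,
        OrbitSpace.ncard_fiber_map_eq_two hΓ hle h2,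
        IsAffineHomotopyLift.exists_lift hle hF hφF hφd fun γ hγ => ?_⟩
      rw [hmem] at hγ ⊢
      -- `φ` leaves `det ρ_{>1}` unchanged, hence maps `Γ_+` into itself.
      rw [← S.detGt_eq_of_comm (hcomm γ), hγ]
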